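/- Work in Baire space $\mathbb{N}^{\mathbb{N}}$, with Cantor space $\{0,1\}^{\mathbb{N}}\subseteq\mathbb{N}^{\mathbb{N}}$; write $\mathbb{N}^*$ for the set of finite strings of natural numbers. For $P,Q\subseteq\mathbb{N}^{\mathbb{N}}$ let $P\le_w Q$ mean that every member of $Q$ Turing-computes some member of $P$; the weak degree $\deg_w(P)$ is the class of $P$ under the equivalence relation induced by $\le_w$, and weak degrees are partially ordered by $\le_w$. Let $\mathcal{E}_w$ be the set of weak degrees of nonempty $\Pi^0_1$ subsets of Cantor space, with this order. A continuous semimeasure on $\mathbb{N}^*$ is a map $\nu\colon\mathbb{N}^*\to[0,1]$ with $\nu(\langle\rangle)=1$ and $\sum_{i}\nu(\sigma^\frown\langle i\rangle)\le\nu(\sigma)$ for all $\sigma$. It is left r.e. if $\nu(\sigma)$ is, uniformly in $\sigma$, the limit of a recursive nondecreasing sequence of rationals. A left r.e. continuous semimeasure $\mathbf{M}$ is universal if for every left r.e. continuous semimeasure $\nu$ on $\mathbb{N}^*$ there is $c\in\mathbb{N}$ with $\nu(\sigma)\le c\,\mathbf{M}(\sigma)$ for all $\sigma$. Fix a universal left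 r.e. continuous semimeasure $\mathbf{M}$. A set $P\subseteq\mathbb{N}^{\mathbb{N}}$ is deep if it is a recursively bounded $\Pi^0_1$ class (that is, it is $\Pi^0_1$ and there is a recursive $h$ with $X(n)<h(n)$ for all $X\in P$ and all $n$) and there is a recursive, nondecreasing, unbounded $r\colon\mathbb{N}\to\mathbb{N}$ such that $$\mathbf{M}(P\restriction r(n)) := \sum_{\sigma\in P\restriction r(n)}\mathbf{M}(\sigma)\le 2^{-n}\quad\text{for all } n\in\mathbb{N},$$ where $P\restriction k$ is the set of initial segments of length $k$ of members of $P$. A degree $\mathbf{p}\in\mathcal{E}_w$ is a deep degree if $\mathbf{p}=\deg_w(P)$ for some nonempty deep $P$. **Proposition.** The deep degrees form a filter in $\langle\mathcal{E}_w,\le\rangle$, i.e., for all $\mathbf{p},\mathbf{q}\in\mathcal{E}_w$: (a) if $\mathbf{p}\le\mathbf{q}$ and $\mathbf{p}$ is a deep degree, then $\mathbf{q}$ is a deep degree; (b) if $\mathbf{p}$ and $\mathbf{q}$ are deep degrees, then the infimum of $\{\mathbf{p},\mathbf{q}\}$ in $\mathcal{E}_w$ exists and is a deep degree. -/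

import Mathlib

open scoped ENNReal Topology

namespace DeepDegrees

/-! Elements of Baire space are functions `ℕ → ℕ`, finite strings are lists of natural numbers. -/

/-- The initial segment of `X` of length `n`. -/
def initSeg (X : ℕ → ℕ) (n : ℕ) : List ℕ := (List.range n).map X

/-- A subset of Baire space is called a mass problem. This is a type of its own because it carries
weak reducibility, not inclusion, as its preorder. -/
def MassProblem : Type := Set (ℕ → ℕ)

/-- Cantor space, as a subset of Baire space. -/
def cantor : Set (ℕ → ℕ) := {X | ∀ n, X n = 0 ∨ X n = 1}

/-- `P` is a `Π⁰₁` class: the set of all `X` all of whose initial segments lie in some recursive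
set of strings. -/
def IsPi01 (P : Set (ℕ → ℕ)) : Prop :=
  ∃ R : List ℕ → Prop, ComputablePred R ∧ P = {X | ∀ n, R (initSeg X n)}

/-- `P` is recursively bounded. -/
def IsRecBounded (P : Set (ℕ → ℕ)) : Prop :=
  ∃ h : ℕ → ℕ, Computable h ∧ ∀ X ∈ P, ∀ n, X n < h n

/-! ### Weak degrees -/

/-- `X` is Turing reducible to `Y`, for points of Baire space. -/
def TuringLE (X Y : ℕ → ℕ) : Prop := TuringReducible (X : ℕ →. ℕ) (Y : ℕ →. ℕ)

/-- Weak (Muchnik) reducibility: every member of `Q` computes a member of `P`. -/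
def WeakLE (P Q : Set (ℕ → ℕ)) : Prop := ∀ Y ∈ Q, ∃ X ∈ P, TuringLE X Y

theorem WeakLE.refl (P : Set (ℕ → ℕ)) : WeakLE P P :=
  fun Y hY => ⟨Y, hY, TuringReducible.refl _⟩

theorem WeakLE.trans {P Q R : Set (ℕ → ℕ)} (h₁ : WeakLE P Q) (h₂ : WeakLE Q R) : WeakLE P R := by
  intro Z hZ
  obtain ⟨Y, hY, hYZ⟩ := h₂ Z hZ
  obtain ⟨X, hX, hXY⟩ := h₁ Y hY
  exact ⟨X, hX, TuringReducible.trans hXY hYZ⟩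

instance : Preorder MassProblem where
  le P Q := WeakLE P Q
  le_refl P := WeakLE.refl P
  le_trans _ _ _ h₁ h₂ := WeakLE.trans h₁ h₂

/-- Weak degrees: mass problems modulo weak equivalence, partially ordered by weak reducibility. -/
abbrev WeakDegree : Type := Antisymmetrization MassProblem (· ≤ ·)

/-- The weak degree of a mass problem. -/
def weakDeg (P : Set (ℕ → ℕ)) : WeakDegree := toAntisymmetrization (α := MassProblem) (· ≤ ·) P

/-- The partial order `E_w` of weak degrees of nonempty `Π⁰₁` subsets of Cantor space, with the
order of the weak degrees. -/
abbrev Ew : Type :=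
  {p : WeakDegree // ∃ P : Set (ℕ → ℕ), P ⊆ cantor ∧ P.Nonempty ∧ IsPi01 P ∧ weakDeg P = p}

/-! ### Continuous semimeasures and depth -/

/-- Continuous semimeasures on the set of finite strings of natural numbers. -/
structure IsContSemimeasure (ν : List ℕ → ℝ≥0∞) : Prop where
  le_one : ∀ σ, ν σ ≤ 1
  root : ν [] = 1
  sum_le : ∀ σ, ∑' i : ℕ, ν (σ ++ [i]) ≤ ν σ

/-- `ν` is left r.e.: uniformly in `σ`, the value `ν σ` is the limit of a recursive nondecreasing
sequence of nonnegative rationals, given by numerators `a σ s` and denominators `b σ s + 1`. -/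
def IsLeftRE (ν : List ℕ → ℝ≥0∞) : Prop :=
  ∃ a b : List ℕ → ℕ → ℕ, Computable₂ a ∧ Computable₂ b ∧
    ∀ σ, Monotone (fun s => (a σ s : ℝ≥0∞) / ((b σ s : ℝ≥0∞) + 1)) ∧
      Filter.Tendsto (fun s => (a σ s : ℝ≥0∞) / ((b σ s : ℝ≥0∞) + 1)) Filter.atTop (𝓝 (ν σ))

/-- `M` is a universal left r.e. continuous semimeasure. -/
structure IsUniversalSemimeasure (M : List ℕ → ℝ≥0∞) : Prop where
  semimeasure : IsContSemimeasure M
  leftRE : IsLeftRE M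
  universal : ∀ ν : List ℕ → ℝ≥0∞, IsContSemimeasure ν → IsLeftRE ν →
    ∃ c : ℕ, ∀ σ, ν σ ≤ c * M σ

/-- The set of initial segments of length `n` of members of `P`. -/
def restrict (P : Set (ℕ → ℕ)) (n : ℕ) : Set (List ℕ) := {σ | ∃ X ∈ P, initSeg X n = σ}

/-- The mass that `ν` gives to a set of strings. -/
noncomputable def mass (ν : List ℕ → ℝ≥0∞) (A : Set (List ℕ)) : ℝ≥0∞ := ∑' σ : A, ν σ

/-- Order functions on the natural numbers: recursive, nondecreasing and unbounded. -/
structure IsOrderFunction (r : ℕ → ℕ) : Prop where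
  computable : Computable r
  monotone : Monotone r
  unbounded : ∀ k, ∃ n, k ≤ r n

/-- `P` is deep with respect to `M`. -/
structure IsDeep (M : List ℕ → ℝ≥0∞) (P : Set (ℕ → ℕ)) : Prop where
  pi01 : IsPi01 P
  recBounded : IsRecBounded P
  modulus : ∃ r : ℕ → ℕ, IsOrderFunction r ∧ ∀ n, mass M (restrict P (r n)) ≤ (2 ^ n)⁻¹

/-- `p` is a deep degree in `E_w`: the weak degree of a nonempty deep class. -/
def IsDeepDegree (M : List ℕ → ℝ≥0∞) (p : Ew) : Prop :=
  ∃ P : Set (ℕ → ℕ), P.Nonempty ∧ IsDeep M P ∧ weakDeg P = p.1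

end DeepDegrees

namespace DeepDegrees

/-! ### Initial segments and `Π⁰₁` classes -/

/-! For (a), let `P` be deep and `Q` a `Π⁰₁` subset of Cantor space with `WeakLE P Q`. Then `pairing
P Q` is weakly equivalent to `Q`, and it is deep (`IsDeep.pairing`): pushing `M` forward along the
first projection gives a left r.e. semimeasure, by universality at most `c * M`, so the mass of the
product is at most `c` times that of `P`; shifting the modulus by `c` absorbs this factor. For (b),
unions give infima among all weak degrees (`isGLB_weakDeg_union`), and a union of deep classes is
deep because masses add (`IsDeep.union`). The union of Cantor space representatives puts the infimum
in `Ew`; the union of deep representatives has the same degree, infima being unique. -/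

theorem length_initSeg (X : ℕ → ℕ) (n : ℕ) : (initSeg X n).length = n := by
  simp [initSeg]

theorem initSeg_succ (X : ℕ → ℕ) (n : ℕ) : initSeg X (n + 1) = initSeg X n ++ [X n] := by
  simp [initSeg, List.range_succ]

theorem map_initSeg (f : ℕ → ℕ) (X : ℕ → ℕ) (n : ℕ) :
    (initSeg X n).map f = initSeg (fun i => f (X i)) n := by
  simp [initSeg, Function.comp_def]

theorem take_initSeg (X : ℕ → ℕ) {k n : ℕ} (h : k ≤ n) : (initSeg X n).take k = initSeg X k := by
  simp [initSeg, ← List.map_take, List.take_range, h]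

theorem computable₂_band : Computable₂ (fun a b : Bool => a && b) := Primrec.and.to_comp

theorem computable₂_bor : Computable₂ (fun a b : Bool => a || b) := Primrec.or.to_comp

theorem computable_list_map {f : ℕ → ℕ} (hf : Primrec f) :
    Computable (fun σ : List ℕ => σ.map f) :=
  (Primrec.list_map Primrec.id (hf.comp Primrec.snd).to₂).to_comp

theorem IsPi01.exists_bool {P : Set (ℕ → ℕ)} (hP : IsPi01 P) :
    ∃ f : List ℕ → Bool, Computable f ∧ ∀ X, X ∈ P ↔ ∀ n, f (initSeg X n) = true := by
  obtain ⟨R, hR, rfl⟩ := hP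
  obtain ⟨f, hf, rfl⟩ := ComputablePred.computable_iff.1 hR
  exact ⟨f, hf, fun X => Iff.rfl⟩

theorem isPi01_of_bool {P : Set (ℕ → ℕ)} {f : List ℕ → Bool} (hf : Computable f)
    (h : ∀ X, X ∈ P ↔ ∀ n, f (initSeg X n) = true) : IsPi01 P :=
  ⟨fun σ => f σ = true, ComputablePred.computable_iff.2 ⟨f, hf, rfl⟩, Set.ext h⟩

/-- The test `f` holds on all prefixes of `σ` of length less than `n`. -/
def prefixTest (f : List ℕ → Bool) (σ : List ℕ) (n : ℕ) : Bool :=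
  Nat.rec true (fun k b => b && f (σ.take k)) n

theorem prefixTest_iff (f : List ℕ → Bool) (σ : List ℕ) (n : ℕ) :
    prefixTest f σ n = true ↔ ∀ k < n, f (σ.take k) = true := by
  induction n with
  | zero => simp [prefixTest]
  | succ n ih =>
    have : prefixTest f σ (n + 1) = (prefixTest f σ n && f (σ.take n)) := rfl
    rw [this, Bool.and_eq_true, ih]
    exact Nat.forall_lt_succ_right.symm

theorem computable_prefixTest {f : List ℕ → Bool} (hf : Computable f) :
    Computable fun σ : List ℕ => prefixTest f σ (σ.length + 1) := by
  have htake : Computable₂ (List.take : ℕ → List ℕ → List ℕ) := Primrec.list_take.to_comp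
  refine Computable.nat_rec (Computable.succ.comp Computable.list_length)
    (Computable.const true) (h := fun σ p => p.2 && f (σ.take p.1)) ?_
  exact computable₂_band.comp (Computable.snd.comp Computable.snd)
    (hf.comp (htake.comp (Computable.fst.comp Computable.snd) Computable.fst))

theorem prefixTest_initSeg (f : List ℕ → Bool) (X : ℕ → ℕ) (n : ℕ) :
    prefixTest f (initSeg X n) ((initSeg X n).length + 1) = true ↔
      ∀ k ≤ n, f (initSeg X k) = true := by
  rw [prefixTest_iff, length_initSeg]
  refine forall_congr' fun k => ?_
  rw [Nat.lt_succ_iff]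
  refine forall_congr' fun hk => ?_
  rw [take_initSeg X hk]

/-- A disjunction of the raw tests could be met by `f` and `g` at different lengths. Testing all
prefixes makes failure permanent, so failures at `m` and `k` both show at `max m k`. -/
theorem IsPi01.union {P Q : Set (ℕ → ℕ)} (hP : IsPi01 P) (hQ : IsPi01 Q) : IsPi01 (P ∪ Q) := by
  obtain ⟨f, hf, hfP⟩ := hP.exists_bool
  obtain ⟨g, hg, hgQ⟩ := hQ.exists_bool
  refine isPi01_of_bool
    (computable₂_bor.comp (computable_prefixTest hf) (computable_prefixTest hg)) fun X => ?_
  simp only [Bool.or_eq_true, prefixTest_initSeg, Set.mem_union, hfP, hgQ]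
  constructor
  · rintro (h | h) n
    · exact Or.inl fun k _ => h k
    · exact Or.inr fun k _ => h k
  · intro h
    by_contra! hc
    obtain ⟨⟨m, hm⟩, k, hk⟩ := hc
    rcases h (max m k) with h | h
    · exact hm (h m (le_max_left _ _))
    · exact hk (h k (le_max_right _ _))

theorem IsRecBounded.union {P Q : Set (ℕ → ℕ)} (hP : IsRecBounded P) (hQ : IsRecBounded Q) :
    IsRecBounded (P ∪ Q) := by
  obtain ⟨h, hh, hP⟩ := hP
  obtain ⟨k, hk, hQ⟩ := hQ
  refine ⟨fun n => h n + k n, Primrec.nat_add.to_comp.comp hh hk, ?_⟩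
  rintro X (hX | hX) n
  · exact (hP X hX n).trans_le (Nat.le_add_right _ _)
  · exact (hQ X hX n).trans_le (Nat.le_add_left _ _)

theorem isRecBounded_of_subset_cantor {P : Set (ℕ → ℕ)} (hP : P ⊆ cantor) : IsRecBounded P := by
  refine ⟨fun _ => 2, Computable.const 2, fun X hX n => ?_⟩
  rcases hP hX n with h | h <;> simp [h]

/-! ### Products of classes -/

/-- The product of two subsets of Baire space, coded back into Baire space coordinatewise. -/
def pairing (P Q : Set (ℕ → ℕ)) : Set (ℕ → ℕ) :=
  {Z | (fun n => (Z n).unpair.1) ∈ P ∧ (fun n => (Z n).unpair.2) ∈ Q}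

theorem IsPi01.pairing {P Q : Set (ℕ → ℕ)} (hP : IsPi01 P) (hQ : IsPi01 Q) :
    IsPi01 (pairing P Q) := by
  obtain ⟨f, hf, hfP⟩ := hP.exists_bool
  obtain ⟨g, hg, hgQ⟩ := hQ.exists_bool
  refine isPi01_of_bool (computable₂_band.comp
    (hf.comp (computable_list_map (Primrec.fst.comp Primrec.unpair)))
    (hg.comp (computable_list_map (Primrec.snd.comp Primrec.unpair)))) fun Z => ?_
  simp only [Bool.and_eq_true, DeepDegrees.pairing, Set.mem_ofPred_eq, hfP, hgQ, forall_and,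
    map_initSeg]

theorem IsRecBounded.pairing {P Q : Set (ℕ → ℕ)} (hP : IsRecBounded P) (hQ : IsRecBounded Q) :
    IsRecBounded (pairing P Q) := by
  obtain ⟨h, hh, hP⟩ := hP
  obtain ⟨k, hk, hQ⟩ := hQ
  refine ⟨fun n => Nat.pair (h n) (k n), Primrec₂.natPair.to_comp.comp hh hk, ?_⟩
  rintro Z ⟨hX, hY⟩ n
  have h₁ := hP _ hX n
  have h₂ := hQ _ hY n
  calc Z n = Nat.pair (Z n).unpair.1 (Z n).unpair.2 := (Nat.pair_unpair _).symm
    _ < Nat.pair (h n) (Z n).unpair.2 := Nat.pair_lt_pair_left _ h₁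
    _ < Nat.pair (h n) (k n) := Nat.pair_lt_pair_right _ h₂

theorem TuringLE.pair {X Y : ℕ → ℕ} (h : TuringLE X Y) :
    TuringLE (fun n => Nat.pair (X n) (Y n)) Y := by
  have h₁ : Nat.RecursiveIn {(Y : ℕ →. ℕ)} (X : ℕ →. ℕ) := RecursiveIn.iff_nat.1 h
  have h₂ : Nat.RecursiveIn {(Y : ℕ →. ℕ)} (Y : ℕ →. ℕ) := .oracle _ rfl
  refine RecursiveIn.iff_nat.2 ((h₁.pair h₂).of_eq fun n => ?_)
  simp [PFun.coe_val, Seq.seq]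

theorem turingLE_unpair_snd (Z : ℕ → ℕ) : TuringLE (fun n => (Z n).unpair.2) Z := by
  have h : Nat.RecursiveIn {(Z : ℕ →. ℕ)} (Z : ℕ →. ℕ) := .oracle _ rfl
  refine RecursiveIn.iff_nat.2 ((Nat.RecursiveIn.right.comp h).of_eq fun n => ?_)
  simp [PFun.coe_val]

theorem weakLE_pairing_right (P Q : Set (ℕ → ℕ)) : WeakLE Q (pairing P Q) :=
  fun Z hZ => ⟨_, hZ.2, turingLE_unpair_snd Z⟩

/-- `Y` computes the pair of itself and the member of `P` that it computes. -/
theorem WeakLE.pairing {P Q : Set (ℕ → ℕ)} (h : WeakLE P Q) : WeakLE (pairing P Q) Q := by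
  intro Y hY
  obtain ⟨X, hX, hXY⟩ := h Y hY
  refine ⟨_, ?_, hXY.pair⟩
  simpa [DeepDegrees.pairing] using ⟨hX, hY⟩

/-! ### Weak degrees -/

theorem weakDeg_le_iff {P Q : Set (ℕ → ℕ)} : weakDeg P ≤ weakDeg Q ↔ WeakLE P Q :=
  toAntisymmetrization_le_toAntisymmetrization_iff (α := MassProblem)

theorem weakDeg_eq_iff {P Q : Set (ℕ → ℕ)} :
    weakDeg P = weakDeg Q ↔ WeakLE P Q ∧ WeakLE Q P := by
  rw [← weakDeg_le_iff, ← weakDeg_le_iff]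
  exact le_antisymm_iff

theorem weakLE_of_superset {P Q : Set (ℕ → ℕ)} (h : Q ⊆ P) : WeakLE P Q :=
  fun Y hY => ⟨Y, h hY, TuringReducible.refl _⟩

theorem weakLE_union_iff {P Q R : Set (ℕ → ℕ)} :
    WeakLE R (P ∪ Q) ↔ WeakLE R P ∧ WeakLE R Q :=
  ⟨fun h => ⟨fun Y hY => h Y (Or.inl hY), fun Y hY => h Y (Or.inr hY)⟩,
    fun h Y hY => hY.elim (h.1 Y) (h.2 Y)⟩

theorem isGLB_weakDeg_union (P Q : Set (ℕ → ℕ)) :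
    IsGLB {weakDeg P, weakDeg Q} (weakDeg (P ∪ Q)) := by
  constructor
  · rintro _ (rfl | rfl)
    · exact weakDeg_le_iff.2 (weakLE_of_superset Set.subset_union_left)
    · exact weakDeg_le_iff.2 (weakLE_of_superset Set.subset_union_right)
  · intro d hd
    induction d using Quotient.inductionOn with
    | _ R =>
      have h₁ : weakDeg R ≤ weakDeg P := hd (by simp)
      have h₂ : weakDeg R ≤ weakDeg Q := hd (by simp)
      exact weakDeg_le_iff.2
        (weakLE_union_iff.2 ⟨weakDeg_le_iff.1 h₁, weakDeg_le_iff.1 h₂⟩)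

/-! ### Masses of restrictions -/

theorem mass_eq_tsum_indicator (ν : List ℕ → ℝ≥0∞) (A : Set (List ℕ)) :
    mass ν A = ∑' σ, A.indicator ν σ :=
  tsum_subtype A ν

theorem tsum_list_eq_tsum_concat {F : List ℕ → ℝ≥0∞} (h : F [] = 0) :
    ∑' σ, F σ = ∑' ρ, ∑' j, F (ρ ++ [j]) := by
  have hinj : Function.Injective fun p : List ℕ × ℕ => p.1 ++ [p.2] := by
    rintro ⟨ρ, i⟩ ⟨τ, j⟩ hp
    simpa using List.append_inj' hp rfl
  have hsupp : Function.support F ⊆ Set.range fun p : List ℕ × ℕ => p.1 ++ [p.2] := by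
    intro σ hσ
    rcases List.eq_nil_or_concat σ with rfl | ⟨ρ, j, rfl⟩
    · exact absurd h hσ
    · exact ⟨(ρ, j), by simp⟩
  rw [← hinj.tsum_eq hsupp]
  exact ENNReal.tsum_prod (f := fun ρ j => F (ρ ++ [j]))

theorem mass_restrict_succ_le {ν : List ℕ → ℝ≥0∞} (hν : IsContSemimeasure ν)
    (P : Set (ℕ → ℕ)) (n : ℕ) : mass ν (restrict P (n + 1)) ≤ mass ν (restrict P n) := by
  have hnil : [] ∉ restrict P (n + 1) := by
    rintro ⟨X, -, hX⟩
    simpa [length_initSeg] using congrArg List.length hX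
  rw [mass_eq_tsum_indicator, mass_eq_tsum_indicator,
    tsum_list_eq_tsum_concat (Set.indicator_of_notMem hnil ν)]
  refine ENNReal.tsum_le_tsum fun ρ => ?_
  by_cases hρ : ρ ∈ restrict P n
  · rw [Set.indicator_of_mem hρ]
    exact (ENNReal.tsum_le_tsum fun j => Set.indicator_le_self _ _ _).trans (hν.sum_le ρ)
  · have hj (j : ℕ) : ρ ++ [j] ∉ restrict P (n + 1) := by
      rintro ⟨X, hX, h⟩
      rw [initSeg_succ] at h
      exact hρ ⟨X, hX, (List.append_inj' h rfl).1⟩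
    simp [Set.indicator_of_notMem (hj _)]

theorem mass_restrict_antitone {ν : List ℕ → ℝ≥0∞} (hν : IsContSemimeasure ν)
    (P : Set (ℕ → ℕ)) : Antitone fun n => mass ν (restrict P n) :=
  antitone_nat_of_succ_le (mass_restrict_succ_le hν P)

theorem mass_union_le (ν : List ℕ → ℝ≥0∞) (A B : Set (List ℕ)) :
    mass ν (A ∪ B) ≤ mass ν A + mass ν B :=
  ENNReal.tsum_union_le ν A B

theorem restrict_union (P Q : Set (ℕ → ℕ)) (n : ℕ) :
    restrict (P ∪ Q) n = restrict P n ∪ restrict Q n := by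
  ext σ
  simp [restrict, or_and_right, exists_or]

theorem IsDeep.union {M : List ℕ → ℝ≥0∞} (hM : IsContSemimeasure M) {P Q : Set (ℕ → ℕ)}
    (hP : IsDeep M P) (hQ : IsDeep M Q) : IsDeep M (P ∪ Q) := by
  refine ⟨hP.pi01.union hQ.pi01, hP.recBounded.union hQ.recBounded, ?_⟩
  obtain ⟨r, hr, hrP⟩ := hP.modulus
  obtain ⟨s, hs, hsQ⟩ := hQ.modulus
  -- Masses decrease with length, so the maximum serves both classes; the shift by one makes the two
  -- bounds add up to `(2 ^ n)⁻¹`.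
  refine ⟨fun n => max (r (n + 1)) (s (n + 1)), ⟨?_, ?_, ?_⟩, fun n => ?_⟩
  · exact Primrec.nat_max.to_comp.comp (hr.computable.comp Computable.succ)
      (hs.computable.comp Computable.succ)
  · intro m n h
    exact max_le_max (hr.monotone (by omega)) (hs.monotone (by omega))
  · intro k
    obtain ⟨n, hn⟩ := hr.unbounded k
    exact ⟨n, hn.trans ((hr.monotone n.le_succ).trans (le_max_left _ _))⟩
  · have h₁ := (mass_restrict_antitone hM P (le_max_left (r (n + 1)) (s (n + 1)))).trans
      (hrP (n + 1))
    have h₂ := (mass_restrict_antitone hM Q (le_max_right (r (n + 1)) (s (n + 1)))).trans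
      (hsQ (n + 1))
    rw [restrict_union]
    refine (mass_union_le M _ _).trans ((add_le_add h₁ h₂).trans_eq ?_)
    rw [pow_succ, ENNReal.mul_inv (by simp) (by simp), ← mul_add, ENNReal.inv_two_add_inv_two,
      mul_one]

/-! ### Push-forwards of semimeasures -/

open Classical in
/-- The push-forward of `ν` under the map of strings that applies `f` to every entry. -/
noncomputable def pushforward (f : ℕ → ℕ) (ν : List ℕ → ℝ≥0∞) (τ : List ℕ) : ℝ≥0∞ :=
  ∑' σ : List ℕ, if σ.map f = τ then ν σ else 0

/-- The fibre over `τ ++ [i]` consists of the `ρ ++ [j]` with `ρ` over `τ` and `f j = i`. Summing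
over `i` frees `j`, leaving the inequality for `ν` at each `ρ`. -/
theorem IsContSemimeasure.pushforward {ν : List ℕ → ℝ≥0∞} (hν : IsContSemimeasure ν)
    (f : ℕ → ℕ) : IsContSemimeasure (pushforward f ν) := by
  classical
  have hroot : DeepDegrees.pushforward f ν [] = 1 := by
    rw [DeepDegrees.pushforward, tsum_eq_single []]
    · simp [hν.root]
    · intro σ hσ
      simp [hσ]
  have hsum (τ : List ℕ) :
      ∑' i, DeepDegrees.pushforward f ν (τ ++ [i]) ≤ DeepDegrees.pushforward f ν τ := by
    have hi (i : ℕ) : DeepDegrees.pushforward f ν (τ ++ [i]) =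
        ∑' ρ : List ℕ, ∑' j, if ρ.map f = τ ∧ f j = i then ν (ρ ++ [j]) else 0 := by
      rw [DeepDegrees.pushforward, tsum_list_eq_tsum_concat (by simp)]
      refine tsum_congr fun ρ => tsum_congr fun j => ?_
      simp only [List.map_append, List.map_cons, List.map_nil]
      refine if_congr ⟨fun h => ?_, fun h => by rw [h.1, h.2]⟩ rfl rfl
      simpa using List.append_inj' h rfl
    simp_rw [hi]
    rw [ENNReal.tsum_comm]
    refine ENNReal.tsum_le_tsum fun ρ => ?_
    rw [ENNReal.tsum_comm]
    by_cases hρ : ρ.map f = τ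
    · simpa [hρ] using hν.sum_le ρ
    · simp [hρ]
  refine ⟨fun τ => ?_, hroot, hsum⟩
  induction τ using List.reverseRecOn with
  | nil => exact hroot.le
  | append_singleton τ i ih => exact (ENNReal.le_tsum i).trans ((hsum τ).trans ih)

theorem mass_le_mass_pushforward (ν : List ℕ → ℝ≥0∞) (f : ℕ → ℕ) {A B : Set (List ℕ)}
    (h : ∀ σ ∈ B, σ.map f ∈ A) : mass ν B ≤ mass (pushforward f ν) A := by
  classical
  calc mass ν B = ∑' σ, B.indicator ν σ := mass_eq_tsum_indicator ν B
    _ ≤ ∑' σ : List ℕ, ∑' τ : A, if σ.map f = τ then ν σ else 0 := by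
      refine ENNReal.tsum_le_tsum fun σ => ?_
      by_cases hσ : σ ∈ B
      · rw [Set.indicator_of_mem hσ]
        refine le_trans ?_ (ENNReal.le_tsum ⟨σ.map f, h σ hσ⟩)
        simp
      · simp [hσ]
    _ = mass (pushforward f ν) A := ENNReal.tsum_comm

/-! ### Left r.e. functions -/

/-- Adding `p.1 / (p.2 + 1)` and `q.1 / (q.2 + 1)`, in the same form. -/
def fracAdd (p q : ℕ × ℕ) : ℕ × ℕ :=
  -- The second entry is `(p.2 + 1) * (q.2 + 1) - 1`.
  (p.1 * (q.2 + 1) + q.1 * (p.2 + 1), p.2 * q.2 + p.2 + q.2)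

/-- The value of the fraction `p.1 / (p.2 + 1)`. -/
noncomputable def fracVal (p : ℕ × ℕ) : ℝ≥0∞ := (p.1 : ℝ≥0∞) / ((p.2 : ℝ≥0∞) + 1)

theorem fracVal_fracAdd (p q : ℕ × ℕ) : fracVal (fracAdd p q) = fracVal p + fracVal q := by
  have hp : ((p.2 : ℝ≥0∞) + 1) ≠ 0 := by simp
  have hp' : ((p.2 : ℝ≥0∞) + 1) ≠ ⊤ := by finiteness
  have hq : ((q.2 : ℝ≥0∞) + 1) ≠ 0 := by simp
  have hq' : ((q.2 : ℝ≥0∞) + 1) ≠ ⊤ := by finiteness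
  have h : (((fracAdd p q).2 : ℕ) : ℝ≥0∞) + 1 = ((p.2 : ℝ≥0∞) + 1) * ((q.2 : ℝ≥0∞) + 1) := by
    simp only [fracAdd]
    push_cast
    ring
  rw [fracVal, h, fracVal, fracVal]
  simp only [fracAdd]
  push_cast
  rw [ENNReal.add_div, ENNReal.mul_div_mul_right _ _ hq hq', mul_comm ((p.2 : ℝ≥0∞) + 1),
    ENNReal.mul_div_mul_right _ _ hp hp']

theorem computable₂_fracAdd : Computable₂ fracAdd := by
  have h₁ : Primrec fun x : (ℕ × ℕ) × ℕ × ℕ => x.1.1 := Primrec.fst.comp Primrec.fst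
  have h₂ : Primrec fun x : (ℕ × ℕ) × ℕ × ℕ => x.1.2 := Primrec.snd.comp Primrec.fst
  have h₃ : Primrec fun x : (ℕ × ℕ) × ℕ × ℕ => x.2.1 := Primrec.fst.comp Primrec.snd
  have h₄ : Primrec fun x : (ℕ × ℕ) × ℕ × ℕ => x.2.2 := Primrec.snd.comp Primrec.snd
  refine Primrec.to_comp (Primrec.pair ?_ ?_)
  · exact Primrec.nat_add.comp (Primrec.nat_mul.comp h₁ (Primrec.succ.comp h₄))
      (Primrec.nat_mul.comp h₃ (Primrec.succ.comp h₂))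
  · exact Primrec.nat_add.comp (Primrec.nat_add.comp (Primrec.nat_mul.comp h₂ h₄) h₂) h₄

/-- The sum of the first `n` values of a sequence of fractions. -/
def fracSum (u : ℕ → ℕ × ℕ) (n : ℕ) : ℕ × ℕ :=
  Nat.rec (0, 0) (fun k s => fracAdd s (u k)) n

theorem fracVal_fracSum (u : ℕ → ℕ × ℕ) (n : ℕ) :
    fracVal (fracSum u n) = ∑ k ∈ Finset.range n, fracVal (u k) := by
  induction n with
  | zero => simp [fracSum, fracVal]
  | succ n ih =>
    have : fracSum u (n + 1) = fracAdd (fracSum u n) (u n) := rfl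
    rw [this, fracVal_fracAdd, ih, Finset.sum_range_succ]

theorem computable_fracSum {α : Type*} [Primcodable α] {u : α → ℕ → ℕ × ℕ} {n : α → ℕ}
    (hu : Computable₂ u) (hn : Computable n) : Computable fun x => fracSum (u x) (n x) :=
  Computable.nat_rec hn (Computable.const (0, 0)) (h := fun x p => fracAdd p.2 (u x p.1))
    (computable₂_fracAdd.comp (Computable.snd.comp Computable.snd)
      (hu.comp Computable.fst (Computable.fst.comp Computable.snd)))

theorem isLeftRE_iff {ν : List ℕ → ℝ≥0∞} :
    IsLeftRE ν ↔ ∃ q : List ℕ → ℕ → ℕ × ℕ, Computable₂ q ∧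
      ∀ σ, Monotone (fun s => fracVal (q σ s)) ∧
        Filter.Tendsto (fun s => fracVal (q σ s)) Filter.atTop (𝓝 (ν σ)) := by
  constructor
  · rintro ⟨a, b, ha, hb, h⟩
    exact ⟨fun σ s => (a σ s, b σ s), Computable.pair ha hb, h⟩
  · rintro ⟨q, hq, h⟩
    exact ⟨fun σ s => (q σ s).1, fun σ s => (q σ s).2, Computable.fst.comp hq,
      Computable.snd.comp hq, h⟩

/-- Monotonicity lets one index `s` govern both the truncation and the stage of approximation: both
sides are suprema. -/
theorem tendsto_sum_range_diagonal {v : ℕ → ℕ → ℝ≥0∞} {w : ℕ → ℝ≥0∞}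
    (hv : ∀ k, Monotone (v k)) (hw : ∀ k, Filter.Tendsto (v k) Filter.atTop (𝓝 (w k))) :
    Monotone (fun s => ∑ k ∈ Finset.range s, v k s) ∧
      Filter.Tendsto (fun s => ∑ k ∈ Finset.range s, v k s) Filter.atTop (𝓝 (∑' k, w k)) := by
  have hmono : Monotone (fun s => ∑ k ∈ Finset.range s, v k s) := fun s t hst =>
    (Finset.sum_le_sum fun k _ => hv k hst).trans
      (Finset.sum_le_sum_of_subset (Finset.range_mono hst))
  refine ⟨hmono, ?_⟩
  have hlim := tendsto_atTop_iSup hmono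
  suffices h : ⨆ s, ∑ k ∈ Finset.range s, v k s = ∑' k, w k by rwa [h] at hlim
  apply le_antisymm
  · refine iSup_le fun s => ?_
    exact (Finset.sum_le_sum fun k _ => (hv k).ge_of_tendsto (hw k) s).trans
      (ENNReal.sum_le_tsum _)
  · rw [ENNReal.tsum_eq_iSup_nat]
    refine iSup_le fun n => ?_
    refine le_of_tendsto_of_tendsto (tendsto_finsetSum (Finset.range n) fun k _ => hw k) hlim ?_
    filter_upwards [Filter.eventually_ge_atTop n] with s hs
    exact Finset.sum_le_sum_of_subset (Finset.range_mono hs)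

theorem IsLeftRE.pushforward {ν : List ℕ → ℝ≥0∞} (hν : IsLeftRE ν) {f : ℕ → ℕ}
    (hf : Primrec f) : IsLeftRE (pushforward f ν) := by
  obtain ⟨q, hq, h⟩ := isLeftRE_iff.1 hν
  -- Fibres may be infinite, so all strings are enumerated, and those outside the fibre contribute
  -- `0 / 1`.
  let u : List ℕ × ℕ → ℕ → ℕ × ℕ := fun x k =>
    bif decide ((Denumerable.ofNat (List ℕ) k).map f = x.1)
      then q (Denumerable.ofNat (List ℕ) k) x.2 else (0, 0)
  have hof : Computable fun y : (List ℕ × ℕ) × ℕ => Denumerable.ofNat (List ℕ) y.2 :=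
    (Computable.ofNat (List ℕ)).comp Computable.snd
  have hdec : Computable₂ fun a b : List ℕ => decide (a = b) :=
    (Primrec.eq (α := List ℕ)).decide.to_comp
  have hu : Computable₂ u :=
    Computable.cond
      (hdec.comp ((computable_list_map hf).comp hof) (Computable.fst.comp Computable.fst))
      (hq.comp hof (Computable.snd.comp Computable.fst)) (Computable.const (0, 0))
  refine isLeftRE_iff.2 ⟨fun τ s => fracSum (u (τ, s)) s,
    computable_fracSum hu Computable.snd, fun τ => ?_⟩
  simp_rw [fracVal_fracSum]
  have hτ : DeepDegrees.pushforward f ν τ = ∑' k : ℕ,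
      if (Denumerable.ofNat (List ℕ) k).map f = τ then ν (Denumerable.ofNat (List ℕ) k) else 0 := by
    classical
    rw [DeepDegrees.pushforward, ← (Denumerable.eqv (List ℕ)).symm.tsum_eq]
    refine tsum_congr fun k => ?_
    simp only [Denumerable.eqv, Equiv.coe_fn_symm_mk]
    congr
  rw [hτ]
  refine tendsto_sum_range_diagonal (v := fun k s => fracVal (u (τ, s) k)) (fun k => ?_)
    fun k => ?_
  · by_cases hk : (Denumerable.ofNat (List ℕ) k).map f = τ
    · simpa [u, hk] using (h (Denumerable.ofNat (List ℕ) k)).1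
    · simpa [u, hk] using monotone_const
  · by_cases hk : (Denumerable.ofNat (List ℕ) k).map f = τ
    · simpa [u, hk] using (h (Denumerable.ofNat (List ℕ) k)).2
    · simp [u, hk, fracVal]

/-! ### Deep classes -/

theorem IsDeep.pairing {M : List ℕ → ℝ≥0∞} (hM : IsUniversalSemimeasure M)
    {P Q : Set (ℕ → ℕ)} (hP : IsDeep M P) (hQ : IsPi01 Q) (hQb : IsRecBounded Q) :
    IsDeep M (pairing P Q) := by
  refine ⟨hP.pi01.pairing hQ, hP.recBounded.pairing hQb, ?_⟩
  obtain ⟨r, hr, hrP⟩ := hP.modulus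
  obtain ⟨c, hc⟩ := hM.universal _ (hM.semimeasure.pushforward fun n => n.unpair.1)
    (hM.leftRE.pushforward (Primrec.fst.comp Primrec.unpair))
  have hadd : Computable fun n => n + c :=
    Primrec.to_comp (Primrec.nat_add.comp Primrec.id (Primrec.const c))
  refine ⟨fun n => r (n + c), ⟨hr.computable.comp hadd, fun m n h => hr.monotone (by omega),
    fun k => ?_⟩, fun n => ?_⟩
  · obtain ⟨n, hn⟩ := hr.unbounded k
    exact ⟨n, hn.trans (hr.monotone (Nat.le_add_right _ _))⟩
  · have hc2 : (c : ℝ≥0∞) ≤ 2 ^ c := by exact_mod_cast Nat.lt_two_pow_self.le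
    calc mass M (restrict (DeepDegrees.pairing P Q) (r (n + c)))
        ≤ mass (pushforward (fun n => n.unpair.1) M) (restrict P (r (n + c))) := by
          refine mass_le_mass_pushforward M _ ?_
          rintro _ ⟨Z, hZ, rfl⟩
          exact ⟨_, hZ.1, (map_initSeg (fun n => n.unpair.1) Z _).symm⟩
      _ ≤ ∑' σ : restrict P (r (n + c)), c * M σ := ENNReal.tsum_le_tsum fun σ => hc σ
      _ = c * mass M (restrict P (r (n + c))) := ENNReal.tsum_mul_left
      _ ≤ 2 ^ c * (2 ^ (n + c))⁻¹ := mul_le_mul' hc2 (hrP _)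
      _ = (2 ^ n)⁻¹ := by
          rw [pow_add, ENNReal.mul_inv (by simp) (by simp), mul_left_comm,
            ENNReal.mul_inv_cancel (by simp) (by simp), mul_one]

end DeepDegrees

theorem mainTheorem7 (M : List ℕ → ℝ≥0∞) (hM : DeepDegrees.IsUniversalSemimeasure M) :
    (∀ p q : DeepDegrees.Ew, p ≤ q → DeepDegrees.IsDeepDegree M p →
      DeepDegrees.IsDeepDegree M q) ∧
    (∀ p q : DeepDegrees.Ew, DeepDegrees.IsDeepDegree M p → DeepDegrees.IsDeepDegree M q →
      ∃ m : DeepDegrees.Ew, IsGLB {p, q} m ∧ DeepDegrees.IsDeepDegree M m) := by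
  open DeepDegrees in
  constructor
  · rintro p ⟨_, Q, hQc, ⟨Y, hY⟩, hQ, rfl⟩ hpq ⟨P, -, hP, hPp⟩
    have hPQ : WeakLE P Q := weakDeg_le_iff.1 (hPp.trans_le hpq)
    obtain ⟨Z, hZ, -⟩ := hPQ.pairing Y hY
    exact ⟨pairing P Q, ⟨Z, hZ⟩, hP.pairing hM hQ (isRecBounded_of_subset_cantor hQc),
      weakDeg_eq_iff.2 ⟨hPQ.pairing, weakLE_pairing_right P Q⟩⟩
  · rintro ⟨_, P', hPc, hPne, hP', rfl⟩ ⟨_, Q', hQc, _, hQ', rfl⟩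
      ⟨P, hne, hP, hPp⟩ ⟨Q, -, hQ, hQq⟩
    have hglb := isGLB_weakDeg_union P' Q'
    have hdeep : weakDeg (P ∪ Q) = weakDeg (P' ∪ Q') := by
      refine IsGLB.unique ?_ hglb
      have := isGLB_weakDeg_union P Q
      rwa [hPp, hQq] at this
    -- `P` and `Q` need not lie in Cantor space, so membership in `Ew` is witnessed by `P' ∪ Q'` and
    -- depth by `P ∪ Q`.
    refine ⟨⟨weakDeg (P' ∪ Q'), P' ∪ Q', Set.union_subset hPc hQc, hPne.inl,
      hP'.union hQ', rfl⟩, ⟨?_, ?_⟩, P ∪ Q, hne.inl, hP.union hM.semimeasure hQ, hdeep⟩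
    · rintro _ (rfl | rfl)
      · exact hglb.1 (by simp)
      · exact hglb.1 (by simp)
    · rintro d hd
      refine hglb.2 ?_
      rintro _ (rfl | rfl)
      · exact hd (Set.mem_insert _ _)
      · exact hd (Set.mem_insert_of_mem _ rfl)
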